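/- Let $K$ be a field, let $H$ be a Hopf algebra over $K$ and let $E$ be a bialgebra over $K$. Let $\pi : E \to H$ be a surjective homomorphism of bialgebras whose kernel $I$ is nilpotent, that is, $I^n = 0$ for some $n \in \mathbb{N}$. Assume that $H$ is formally smooth as a $K$-algebra, that is, the $H$-bimodule $\Omega^1 H := \ker(m : H \otimes_K H \to H)$, where $m$ is the multiplication, is projective relative to the class of all homomorphisms of $H$-bimodules that split as $K$-linear maps. Regard $H$ as a right $H$-comodule through its comultiplication $\Delta_H$, and $E$ as a right $H$-comodule through $(\mathrm{id}_E \otimes \pi)\circ\Delta_E$. Then there is a homomorphism of $K$-algebras $s : H \to E$ such that $\pi \circ s = \mathrm{id}_H$ and $s$ is right $H$-colinear, that is, $(\mathrm{id}_E \otimes \pi)\circ \Delta_E \circ s = (s \otimes \mathrm{id}_H)\circ \Delta_H$. -/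

import Mathlib

universe u v w

open scoped TensorProduct

/-! ### Bimodules and formally smooth algebras

An `A`-bimodule, for a `K`-algebra `A`, is a `K`-vector space with a left action of `A` and a right
action of `A` (an action of `Aᵐᵒᵖ`) that commute with each other and are compatible with the action
of `K`. -/

/-- A `K`-linear map between `A`-bimodules is a homomorphism of bimodules if it is left and right
`A`-linear. -/
structure IsBimoduleHom (K : Type u) (A : Type v) {X Y : Type w} [Field K] [Ring A] [Algebra K A]
    [AddCommGroup X] [Module K X] [Module A X] [Module Aᵐᵒᵖ X]
    [AddCommGroup Y] [Module K Y] [Module A Y] [Module Aᵐᵒᵖ Y]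
    (f : X →ₗ[K] Y) : Prop where
  map_left : ∀ (a : A) (x : X), f (a • x) = a • f x
  map_right : ∀ (a : A) (x : X), f (MulOpposite.op a • x) = MulOpposite.op a • f x

/-- The `A`-bimodule `P` is projective relative to the class of all homomorphisms of `A`-bimodules
that split as `K`-linear maps: for each such `g : X → Y`, the map `Hom(P, X) → Hom(P, Y)` of
composition with `g` is surjective. -/
def IsRelProjectiveBimodule (K : Type u) (A P : Type v) [Field K] [Ring A] [Algebra K A]
    [AddCommGroup P] [Module K P] [Module A P] [Module Aᵐᵒᵖ P]
    [IsScalarTower K A P] [IsScalarTower K Aᵐᵒᵖ P] [SMulCommClass A Aᵐᵒᵖ P] : Prop :=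
  ∀ (X Y : Type v)
    [AddCommGroup X] [Module K X] [Module A X] [Module Aᵐᵒᵖ X]
    [IsScalarTower K A X] [IsScalarTower K Aᵐᵒᵖ X] [SMulCommClass A Aᵐᵒᵖ X]
    [AddCommGroup Y] [Module K Y] [Module A Y] [Module Aᵐᵒᵖ Y]
    [IsScalarTower K A Y] [IsScalarTower K Aᵐᵒᵖ Y] [SMulCommClass A Aᵐᵒᵖ Y]
    (g : X →ₗ[K] Y), IsBimoduleHom K A g → (∃ t : Y →ₗ[K] X, g ∘ₗ t = LinearMap.id) →
    ∀ f : P →ₗ[K] Y, IsBimoduleHom K A f → ∃ h : P →ₗ[K] X, IsBimoduleHom K A h ∧ g ∘ₗ h = f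

/-- The kernel `Ω¹A` of the multiplication map `A ⊗ A → A`. -/
abbrev OmegaOne (K : Type u) (A : Type v) [Field K] [Ring A] [Algebra K A] : Type v :=
  LinearMap.ker (LinearMap.mul' K A)

namespace OmegaOne

variable {K : Type u} {A : Type v} [Field K] [Ring A] [Algebra K A]

theorem mul'_left (a : A) (z : A ⊗[K] A) :
    LinearMap.mul' K A ((a ⊗ₜ 1) * z) = a * LinearMap.mul' K A z := by
  induction z with
  | zero => simp
  | tmul x y => simp [mul_assoc]
  | add x y hx hy => simp [mul_add, hx, hy]

theorem mul'_right (a : A) (z : A ⊗[K] A) :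
    LinearMap.mul' K A (z * (1 ⊗ₜ a)) = LinearMap.mul' K A z * a := by
  induction z with
  | zero => simp
  | tmul x y => simp [mul_assoc]
  | add x y hx hy => simp [add_mul, hx, hy]

/-- The left action `a • (x ⊗ y) = (a * x) ⊗ y`. -/
instance instModuleLeft : Module A (OmegaOne K A) where
  smul a z := ⟨(a ⊗ₜ 1) * z.1, by rw [LinearMap.mem_ker, mul'_left, z.2, mul_zero]⟩
  one_smul z := Subtype.ext (one_mul z.1)
  mul_smul a b z := Subtype.ext <| by
    change ((a * b) ⊗ₜ[K] (1 : A)) * z.1 = (a ⊗ₜ 1) * ((b ⊗ₜ 1) * z.1)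
    rw [← mul_assoc, Algebra.TensorProduct.tmul_mul_tmul, one_mul]
  smul_zero a := Subtype.ext (mul_zero _)
  smul_add a x y := Subtype.ext (mul_add _ _ _)
  add_smul a b z := Subtype.ext <| by
    change ((a + b) ⊗ₜ[K] (1 : A)) * z.1 = (a ⊗ₜ 1) * z.1 + (b ⊗ₜ 1) * z.1
    rw [TensorProduct.add_tmul, add_mul]
  zero_smul z := Subtype.ext <| by
    change ((0 : A) ⊗ₜ[K] (1 : A)) * z.1 = 0
    rw [TensorProduct.zero_tmul, zero_mul]

/-- The right action `(x ⊗ y) • a = x ⊗ (y * a)`. -/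
instance instModuleRight : Module Aᵐᵒᵖ (OmegaOne K A) where
  smul a z := ⟨z.1 * (1 ⊗ₜ a.unop), by rw [LinearMap.mem_ker, mul'_right, z.2, zero_mul]⟩
  one_smul z := Subtype.ext (mul_one z.1)
  mul_smul a b z := Subtype.ext <| by
    change z.1 * ((1 : A) ⊗ₜ[K] (b.unop * a.unop)) = z.1 * (1 ⊗ₜ b.unop) * (1 ⊗ₜ a.unop)
    rw [mul_assoc, Algebra.TensorProduct.tmul_mul_tmul, one_mul]
  smul_zero a := Subtype.ext (zero_mul _)
  smul_add a x y := Subtype.ext (add_mul _ _ _)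
  add_smul a b z := Subtype.ext <| by
    change z.1 * ((1 : A) ⊗ₜ[K] (a.unop + b.unop)) = z.1 * (1 ⊗ₜ a.unop) + z.1 * (1 ⊗ₜ b.unop)
    rw [TensorProduct.tmul_add, mul_add]
  zero_smul z := Subtype.ext <| by
    change z.1 * ((1 : A) ⊗ₜ[K] (0 : A)) = 0
    rw [TensorProduct.tmul_zero, mul_zero]

theorem coe_smul (a : A) (z : OmegaOne K A) :
    ((a • z : OmegaOne K A) : A ⊗[K] A) = (a ⊗ₜ 1) * (z : A ⊗[K] A) := rfl

theorem coe_op_smul (a : Aᵐᵒᵖ) (z : OmegaOne K A) :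
    ((a • z : OmegaOne K A) : A ⊗[K] A) = (z : A ⊗[K] A) * (1 ⊗ₜ a.unop) := rfl

instance instScalarTowerLeft : IsScalarTower K A (OmegaOne K A) where
  smul_assoc k a z := Subtype.ext <| by
    rw [Submodule.coe_smul, coe_smul, coe_smul, ← TensorProduct.smul_tmul', smul_mul_assoc]

instance instScalarTowerRight : IsScalarTower K Aᵐᵒᵖ (OmegaOne K A) where
  smul_assoc k a z := Subtype.ext <| by
    rw [Submodule.coe_smul, coe_op_smul, coe_op_smul, MulOpposite.unop_smul,
      TensorProduct.tmul_smul, mul_smul_comm]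

instance instSMulComm : SMulCommClass A Aᵐᵒᵖ (OmegaOne K A) where
  smul_comm a b z := Subtype.ext <| by
    rw [coe_smul, coe_op_smul, coe_op_smul, coe_smul, mul_assoc]

end OmegaOne

/-- The (not necessarily commutative) `K`-algebra `A` is formally smooth, as an algebra in the
monoidal category of `K`-vector spaces: the `A`-bimodule `Ω¹A` is projective relative to the
bimodule homomorphisms that split as `K`-linear maps. -/
def IsFormallySmoothAlgebra (K : Type u) (A : Type v) [Field K] [Ring A] [Algebra K A] : Prop :=
  IsRelProjectiveBimodule K A (OmegaOne K A)

/-! ### Right comodules -/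

/-- The structure of a right `C`-comodule on the vector space `V`. -/
structure RightComodule (K : Type u) (C : Type v) (V : Type w) [Field K]
    [AddCommGroup C] [Module K C] [Coalgebra K C] [AddCommGroup V] [Module K V] where
  coact : V →ₗ[K] V ⊗[K] C
  coassoc : (TensorProduct.assoc K V C C).toLinearMap ∘ₗ coact.rTensor C ∘ₗ coact =
    (Coalgebra.comul (R := K) (A := C)).lTensor V ∘ₗ coact
  counit_coact : (Coalgebra.counit (R := K) (A := C)).lTensor V ∘ₗ coact =
    (TensorProduct.mk K V K).flip 1

namespace RightComodule

variable {K : Type u} {C : Type v} {V : Type w} [Field K]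
  [AddCommGroup C] [Module K C] [Coalgebra K C] [AddCommGroup V] [Module K V]

/-- A coalgebra as a right comodule over itself, through its comultiplication. -/
def regular (K : Type u) (C : Type v) [Field K] [AddCommGroup C] [Module K C] [Coalgebra K C] :
    RightComodule K C C where
  coact := Coalgebra.comul
  coassoc := Coalgebra.coassoc
  counit_coact := Coalgebra.lTensor_counit_comp_comul

/-- A coalgebra `V` with a coalgebra homomorphism `p : V → C` as a right `C`-comodule, with coaction
`x ↦ x₁ ⊗ p x₂`. -/
def ofCoalgHom [Coalgebra K V] (p : V →ₗc[K] C) : RightComodule K C V where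
  coact := p.toLinearMap.lTensor V ∘ₗ Coalgebra.comul
  coassoc := by
    have h1 : (TensorProduct.assoc K V C C).toLinearMap ∘ₗ
        (p.toLinearMap.lTensor V ∘ₗ Coalgebra.comul).rTensor C ∘ₗ p.toLinearMap.lTensor V =
        (TensorProduct.map p.toLinearMap p.toLinearMap).lTensor V ∘ₗ
          (TensorProduct.assoc K V V V).toLinearMap ∘ₗ
          (Coalgebra.comul (R := K) (A := V)).rTensor V := by
      apply TensorProduct.ext'
      intro x y
      simp only [LinearMap.comp_apply, LinearMap.lTensor_tmul, LinearMap.rTensor_tmul]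
      induction Coalgebra.comul (R := K) x with
      | zero => simp
      | tmul a b => simp
      | add a b ha hb => simp only [map_add, TensorProduct.add_tmul, ha, hb]
    calc _ = ((TensorProduct.assoc K V C C).toLinearMap ∘ₗ
        (p.toLinearMap.lTensor V ∘ₗ Coalgebra.comul).rTensor C ∘ₗ p.toLinearMap.lTensor V) ∘ₗ
          Coalgebra.comul := rfl
      _ = (TensorProduct.map p.toLinearMap p.toLinearMap).lTensor V ∘ₗ
          ((TensorProduct.assoc K V V V).toLinearMap ∘ₗ
          (Coalgebra.comul (R := K) (A := V)).rTensor V ∘ₗ Coalgebra.comul) := by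
        rw [h1]; rfl
      _ = _ := by
        rw [Coalgebra.coassoc, ← LinearMap.comp_assoc, ← LinearMap.comp_assoc,
          ← LinearMap.lTensor_comp, ← LinearMap.lTensor_comp, p.map_comp_comul]
  counit_coact := by
    rw [← LinearMap.comp_assoc, ← LinearMap.lTensor_comp, p.counit_comp,
      Coalgebra.lTensor_counit_comp_comul]

end RightComodule

/-- A `K`-linear map between right `C`-comodules is right colinear if it commutes with the
coactions. -/
def IsRightColinear {K : Type u} {C : Type v} {V W : Type*} [Field K]
    [AddCommGroup C] [Module K C] [Coalgebra K C]
    [AddCommGroup V] [Module K V] [AddCommGroup W] [Module K W]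
    (ρV : RightComodule K C V) (ρW : RightComodule K C W) (f : V →ₗ[K] W) : Prop :=
  ρW.coact ∘ₗ f = f.rTensor C ∘ₗ ρV.coact

/-! The section is built by Newton iteration along the powers `I ^ 2 ^ k`, where `I` is the kernel
of `π`; they vanish for `k = n`. Each step replaces an error in an ideal `J` by one in `J * J`, and
changes the map only within `J`, so it remains a section of `π`.

A first iteration (`exists_colinear_mod_mul_self`) makes a unital linear section `σ` colinear. The
corrected map is `h ↦ y₀ * σ (S y₁ * h₂)` with `y = σ h₁`; it equals `σ` if `σ` is already colinear.

A second iteration (`exists_multiplicative_mod_mul_self`) makes the colinear section multiplicative.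
Its curvature `ω (x ⊗ y) = s (x * y) - s x * s y` is a Hochschild 2-cocycle modulo `J * J`. Formal
smoothness yields a derivation `D` lifting `x ↦ x ⊗ 1 - 1 ⊗ x` along the bar differential, and
evaluating `ω · s` on `D` gives a cochain that cancels the curvature.

Colinearity survives the second iteration if `D` is colinear, which `exists_colinear_derivation`
arranges. The tool is the isomorphism `x ⊗ h ↦ x₀ ⊗ S x₁ * h` of `V ⊗ H`, which turns the coaction
on the factor `H` into the diagonal one. The data of `D` can thus be compressed to `H → H ⊗ H` by
applying `ε` to the last factor, then re-expanded colinearly. -/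

/-! ### Collecting coefficients of tensors. -/

section TensorCoaction

open TensorProduct Coalgebra

variable {K : Type u} [Field K]

/-- The map `(x ⊗ a) ⊗ (y ⊗ b) ↦ (x ⊗ y) ⊗ a * b` that collects the coefficients of two tensors. -/
def collectCoeff (K : Type u) [Field K] (V W A : Type*) [AddCommGroup V] [Module K V]
    [AddCommGroup W] [Module K W] [Ring A] [Algebra K A] :
    (V ⊗[K] A) ⊗[K] (W ⊗[K] A) →ₗ[K] (V ⊗[K] W) ⊗[K] A :=
  (LinearMap.mul' K A).lTensor (V ⊗[K] W) ∘ₗ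
    (TensorProduct.tensorTensorTensorComm K V A W A).toLinearMap

variable {V W V' W' U A B : Type*} [AddCommGroup V] [Module K V] [AddCommGroup W] [Module K W]
  [AddCommGroup V'] [Module K V'] [AddCommGroup W'] [Module K W'] [AddCommGroup U] [Module K U]
  [Ring A] [Algebra K A] [Ring B] [Algebra K B]

@[simp]
theorem collectCoeff_tmul (x : V) (a : A) (y : W) (b : A) :
    collectCoeff K V W A ((x ⊗ₜ a) ⊗ₜ (y ⊗ₜ b)) = (x ⊗ₜ y) ⊗ₜ (a * b) := rfl

/-- Two linear maps out of a tensor product of two tensor products agree if they agree on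
elementary tensors. -/
theorem TensorProduct.apply_tmul_eq_of_tmul_tmul {f g : (V ⊗[K] V') ⊗[K] (W ⊗[K] W') →ₗ[K] U}
    (h : ∀ x a y b, f ((x ⊗ₜ a) ⊗ₜ (y ⊗ₜ b)) = g ((x ⊗ₜ a) ⊗ₜ (y ⊗ₜ b)))
    (p : V ⊗[K] V') (q : W ⊗[K] W') : f (p ⊗ₜ q) = g (p ⊗ₜ q) := by
  induction p with
  | zero => simp
  | add p p' hp hp' => simp only [add_tmul, map_add, hp, hp']
  | tmul x a =>
    induction q with
    | zero => simp
    | add q q' hq hq' => simp only [tmul_add, map_add, hq, hq']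
    | tmul y b => exact h x a y b

theorem lTensor_collectCoeff (φ : A →ₐ[K] B) (p : V ⊗[K] A) (q : W ⊗[K] A) :
    φ.toLinearMap.lTensor (V ⊗[K] W) (collectCoeff K V W A (p ⊗ₜ q)) =
      collectCoeff K V W B (φ.toLinearMap.lTensor V p ⊗ₜ φ.toLinearMap.lTensor W q) := by
  refine TensorProduct.apply_tmul_eq_of_tmul_tmul
    (f := φ.toLinearMap.lTensor (V ⊗[K] W) ∘ₗ collectCoeff K V W A)
    (g := collectCoeff K V W B ∘ₗ
      TensorProduct.map (φ.toLinearMap.lTensor V) (φ.toLinearMap.lTensor W)) ?_ p q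
  intro x a y b
  simp

theorem rTensor_map_collectCoeff (f : V →ₗ[K] V') (g : W →ₗ[K] W') (p : V ⊗[K] A)
    (q : W ⊗[K] A) :
    (TensorProduct.map f g).rTensor A (collectCoeff K V W A (p ⊗ₜ q)) =
      collectCoeff K V' W' A (f.rTensor A p ⊗ₜ g.rTensor A q) := by
  refine TensorProduct.apply_tmul_eq_of_tmul_tmul
    (f := (TensorProduct.map f g).rTensor A ∘ₗ collectCoeff K V W A)
    (g := collectCoeff K V' W' A ∘ₗ TensorProduct.map (f.rTensor A) (g.rTensor A)) ?_ p q
  intro x a y b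
  simp

theorem rTensor_mul'_collectCoeff (p q : B ⊗[K] A) :
    (LinearMap.mul' K B).rTensor A (collectCoeff K B B A (p ⊗ₜ q)) = p * q := by
  refine TensorProduct.apply_tmul_eq_of_tmul_tmul
    (f := (LinearMap.mul' K B).rTensor A ∘ₗ collectCoeff K B B A)
    (g := LinearMap.mul' K (B ⊗[K] A)) ?_ p q
  intro x a y b
  simp

end TensorCoaction

/-! ### Diagonal coactions and the twist isomorphism. -/

namespace RightComodule

open TensorProduct Coalgebra

variable {K : Type u} {H : Type v} [Field K] {V W : Type*}
  [AddCommGroup V] [Module K V] [AddCommGroup W] [Module K W]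

section Coalgebra

variable [AddCommGroup H] [Module K H] [Coalgebra K H]

theorem coassoc_apply (M : RightComodule K H V) (x : V) :
    TensorProduct.assoc K V H H (M.coact.rTensor H (M.coact x)) =
      (comul (R := K) (A := H)).lTensor V (M.coact x) :=
  LinearMap.congr_fun M.coassoc x

theorem counit_coact_apply (M : RightComodule K H V) (x : V) :
    (counit (R := K) (A := H)).lTensor V (M.coact x) = x ⊗ₜ 1 :=
  LinearMap.congr_fun M.counit_coact x

end Coalgebra

variable [Ring H]

/-- The tensor product of two right comodules over a bialgebra, with the diagonal coaction
`x ⊗ y ↦ (x₀ ⊗ y₀) ⊗ x₁ * y₁`. -/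
def tensor [Bialgebra K H] (M : RightComodule K H V) (N : RightComodule K H W) :
    RightComodule K H (V ⊗[K] W) where
  coact := collectCoeff K V W H ∘ₗ TensorProduct.map M.coact N.coact
  coassoc := by
    have key (p : V ⊗[K] H) (q : W ⊗[K] H) : TensorProduct.assoc K (V ⊗[K] W) H H
        ((collectCoeff K V W H ∘ₗ TensorProduct.map M.coact N.coact).rTensor H
          (collectCoeff K V W H (p ⊗ₜ q))) = collectCoeff K V W (H ⊗[K] H)
        (TensorProduct.assoc K V H H (M.coact.rTensor H p) ⊗ₜ
          TensorProduct.assoc K W H H (N.coact.rTensor H q)) := by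
      refine TensorProduct.apply_tmul_eq_of_tmul_tmul
        (f := (TensorProduct.assoc K (V ⊗[K] W) H H).toLinearMap ∘ₗ
          (collectCoeff K V W H ∘ₗ TensorProduct.map M.coact N.coact).rTensor H ∘ₗ
          collectCoeff K V W H)
        (g := collectCoeff K V W (H ⊗[K] H) ∘ₗ TensorProduct.map
          ((TensorProduct.assoc K V H H).toLinearMap ∘ₗ M.coact.rTensor H)
          ((TensorProduct.assoc K W H H).toLinearMap ∘ₗ N.coact.rTensor H)) ?_ p q
      intro x a y b
      simp only [LinearMap.comp_apply, collectCoeff_tmul, LinearMap.rTensor_tmul, map_tmul,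
        LinearEquiv.coe_coe]
      refine TensorProduct.apply_tmul_eq_of_tmul_tmul
        (f := (TensorProduct.assoc K (V ⊗[K] W) H H).toLinearMap ∘ₗ
          (TensorProduct.mk K _ H).flip (a * b) ∘ₗ collectCoeff K V W H)
        (g := collectCoeff K V W (H ⊗[K] H) ∘ₗ TensorProduct.map
          ((TensorProduct.assoc K V H H).toLinearMap ∘ₗ (TensorProduct.mk K _ H).flip a)
          ((TensorProduct.assoc K W H H).toLinearMap ∘ₗ (TensorProduct.mk K _ H).flip b)) ?_ _ _
      intro x' a' y' b'
      simp
    apply TensorProduct.ext'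
    intro x y
    simp only [LinearMap.comp_apply, LinearEquiv.coe_coe, map_tmul]
    rw [key, coassoc_apply, coassoc_apply]
    exact (lTensor_collectCoeff (Bialgebra.comulAlgHom K H) _ _).symm
  counit_coact := by
    apply TensorProduct.ext'
    intro x y
    simp only [LinearMap.comp_apply, map_tmul]
    refine (lTensor_collectCoeff (Bialgebra.counitAlgHom K H) _ _).trans ?_
    simp only [Bialgebra.toLinearMap_counitAlgHom, counit_coact_apply]
    simp

theorem tensor_coact_tmul [Bialgebra K H] (M : RightComodule K H V) (N : RightComodule K H W)
    (x : V) (y : W) : (M.tensor N).coact (x ⊗ₜ y) =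
      collectCoeff K V W H (M.coact x ⊗ₜ N.coact y) := rfl

section Twist

variable [Bialgebra K H]

/-- The endomorphism `x ⊗ h ↦ x₀ ⊗ φ x₁ * h` of `V ⊗ H`, for a right comodule `V`. -/
def twist (M : RightComodule K H V) (φ : H →ₗ[K] H) : V ⊗[K] H →ₗ[K] V ⊗[K] H :=
  (LinearMap.mul' K H ∘ₗ φ.rTensor H).lTensor V ∘ₗ (TensorProduct.assoc K V H H).toLinearMap ∘ₗ
    M.coact.rTensor H

theorem twist_tmul (M : RightComodule K H V) (φ : H →ₗ[K] H) (x : V) (h : H) :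
    M.twist φ (x ⊗ₜ h) = (LinearMap.mulRight K h ∘ₗ φ).lTensor V (M.coact x) := by
  simp only [twist, LinearMap.comp_apply, LinearMap.rTensor_tmul, LinearEquiv.coe_coe]
  induction M.coact x with
  | zero => simp
  | add p q hp hq => simp only [add_tmul, map_add, hp, hq]
  | tmul y a => simp

/-- By coassociativity, twists compose as their parameters do under convolution. Hence twisting by
the antipode inverts twisting by the identity. -/
theorem twist_twist (M : RightComodule K H V) (φ ψ : H →ₗ[K] H) (z : V ⊗[K] H) :
    M.twist φ (M.twist ψ z) =
      M.twist (LinearMap.mul' K H ∘ₗ TensorProduct.map φ ψ ∘ₗ comul) z := by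
  induction z with
  | zero => simp
  | add p q hp hq => simp only [map_add, hp, hq]
  | tmul x h =>
    have key (p : V ⊗[K] H) : M.twist φ ((LinearMap.mulRight K h ∘ₗ ψ).lTensor V p) =
        (LinearMap.mulRight K h ∘ₗ LinearMap.mul' K H ∘ₗ TensorProduct.map φ ψ).lTensor V
          (TensorProduct.assoc K V H H (M.coact.rTensor H p)) := by
      induction p with
      | zero => simp
      | add p q hp hq => simp only [map_add, hp, hq]
      | tmul y a =>
        simp only [LinearMap.lTensor_tmul, twist_tmul, LinearMap.rTensor_tmul]
        induction M.coact y with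
        | zero => simp
        | add p q hp hq => simp only [map_add, add_tmul, hp, hq]
        | tmul y' b => simp [mul_assoc]
    rw [twist_tmul, key, coassoc_apply, twist_tmul, ← LinearMap.comp_apply,
      ← LinearMap.lTensor_comp]
    rfl

theorem twist_counit (M : RightComodule K H V) (z : V ⊗[K] H) :
    M.twist (Algebra.linearMap K H ∘ₗ counit) z = z := by
  induction z with
  | zero => simp
  | add p q hp hq => simp only [map_add, hp, hq]
  | tmul x h =>
    rw [twist_tmul, ← LinearMap.comp_assoc, LinearMap.lTensor_comp, LinearMap.comp_apply,
      counit_coact_apply]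
    simp

/-- On `x ⊗ h` both sides are `(x₀ ⊗ x₁ * h₁) ⊗ x₂ * h₂`, since `Δ` is multiplicative. So the twist
by the identity carries the diagonal coaction to the coaction on the factor `H`. -/
theorem twist_id_tensor_coact (M : RightComodule K H V) (z : V ⊗[K] H) :
    (M.twist LinearMap.id).rTensor H ((M.tensor (regular K H)).coact z) =
      (TensorProduct.assoc K V H H).symm (comul.lTensor V (M.twist LinearMap.id z)) := by
  induction z with
  | zero => simp
  | add p q hp hq => simp only [map_add, hp, hq]
  | tmul x h =>
    have h1 (p : V ⊗[K] H) : (comul (R := K)).lTensor V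
        ((LinearMap.mulRight K h ∘ₗ LinearMap.id).lTensor V p) =
        (LinearMap.mulRight K (comul (R := K) h)).lTensor V ((comul (R := K)).lTensor V p) := by
      induction p with
      | zero => simp
      | add p q hp hq => simp only [map_add, hp, hq]
      | tmul y a => simp
    have h2 (p : V ⊗[K] H) (q : H ⊗[K] H) : (M.twist LinearMap.id).rTensor H
        (collectCoeff K V H H (p ⊗ₜ q)) = (TensorProduct.assoc K V H H).symm
        ((LinearMap.mulRight K q).lTensor V
          (TensorProduct.assoc K V H H (M.coact.rTensor H p))) := by
      induction p with
      | zero => simp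
      | add p q hp hq => simp only [map_add, add_tmul, hp, hq]
      | tmul y a =>
        induction q with
        | zero =>
          have h0 : LinearMap.mulRight K (0 : H ⊗[K] H) = 0 := by ext; simp
          simp [h0]
        | add p q hp hq =>
          have h0 : LinearMap.mulRight K (p + q) =
              LinearMap.mulRight K p + LinearMap.mulRight K q := by
            ext; simp [mul_add]
          simp only [map_add, tmul_add, hp, hq, h0, LinearMap.lTensor_add, LinearMap.add_apply]
        | tmul c d =>
          simp only [collectCoeff_tmul, LinearMap.rTensor_tmul, twist_tmul]
          induction M.coact y with
          | zero => simp
          | add p q hp hq => simp only [map_add, add_tmul, hp, hq]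
          | tmul y' b => simp
    rw [tensor_coact_tmul, twist_tmul, h1, h2, coassoc_apply]
    rfl

theorem twist_map {M : RightComodule K H V} {N : RightComodule K H W} {f : V →ₗ[K] W}
    (hf : IsRightColinear M N f) (φ : H →ₗ[K] H) (z : V ⊗[K] H) :
    N.twist φ (f.rTensor H z) = f.rTensor H (M.twist φ z) := by
  induction z with
  | zero => simp
  | add p q hp hq => simp only [map_add, hp, hq]
  | tmul x h =>
    have h1 : N.coact (f x) = f.rTensor H (M.coact x) := LinearMap.congr_fun hf x
    rw [LinearMap.rTensor_tmul, twist_tmul, twist_tmul, h1]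
    exact (LinearMap.congr_fun (LinearMap.lTensor_comp_rTensor _ _ _) _).trans
      (LinearMap.congr_fun (LinearMap.rTensor_comp_lTensor _ _ _) _).symm

end Twist

section Antipode

variable [HopfAlgebra K H]

theorem twist_antipode_twist_id (M : RightComodule K H V) (z : V ⊗[K] H) :
    M.twist (HopfAlgebra.antipode K) (M.twist LinearMap.id z) = z := by
  rw [twist_twist]
  have : LinearMap.mul' K H ∘ₗ TensorProduct.map (HopfAlgebra.antipode K) LinearMap.id ∘ₗ comul =
      Algebra.linearMap K H ∘ₗ counit := HopfAlgebra.mul_antipode_rTensor_comul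
  rw [this, twist_counit]

theorem twist_id_twist_antipode (M : RightComodule K H V) (z : V ⊗[K] H) :
    M.twist LinearMap.id (M.twist (HopfAlgebra.antipode K) z) = z := by
  rw [twist_twist]
  have : LinearMap.mul' K H ∘ₗ TensorProduct.map LinearMap.id (HopfAlgebra.antipode K) ∘ₗ comul =
      Algebra.linearMap K H ∘ₗ counit := HopfAlgebra.mul_antipode_lTensor_comul
  rw [this, twist_counit]

/-- The map `x ⊗ h ↦ x₀ ⊗ S x₁ * h` takes the coaction on the right factor of `V ⊗ H` to the
diagonal coaction. -/
theorem tensor_coact_twist_antipode (M : RightComodule K H V) (z : V ⊗[K] H) :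
    (M.tensor (regular K H)).coact (M.twist (HopfAlgebra.antipode K) z) =
      (M.twist (HopfAlgebra.antipode K)).rTensor H
        ((TensorProduct.assoc K V H H).symm (comul.lTensor V z)) := by
  have h := M.twist_id_tensor_coact (M.twist (HopfAlgebra.antipode K) z)
  rw [twist_id_twist_antipode] at h
  rw [← h, ← LinearMap.rTensor_comp_apply]
  have : M.twist (HopfAlgebra.antipode K) ∘ₗ M.twist LinearMap.id = LinearMap.id :=
    LinearMap.ext M.twist_antipode_twist_id
  rw [this, LinearMap.rTensor_id, LinearMap.id_apply]

theorem twist_antipode_coact (M : RightComodule K H V) (x : V) :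
    M.twist (HopfAlgebra.antipode K) (M.coact x) = x ⊗ₜ 1 := by
  have : M.coact x = M.twist LinearMap.id (x ⊗ₜ 1) := by
    rw [twist_tmul]; simp
  rw [this, twist_antipode_twist_id]

end Antipode

end RightComodule

/-! ### The bar differential and formal smoothness. -/

section BarComplex

open TensorProduct

variable (K : Type u) (A : Type v) [Field K] [Ring A] [Algebra K A]

/-- The differential `(x ⊗ y) ⊗ z ↦ x * y ⊗ z - x ⊗ y * z` of the bar complex. -/
def barDifferential : (A ⊗[K] A) ⊗[K] A →ₗ[K] A ⊗[K] A :=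
  (LinearMap.mul' K A).rTensor A -
    (LinearMap.mul' K A).lTensor A ∘ₗ (TensorProduct.assoc K A A A).toLinearMap

variable {K A}

@[simp]
theorem barDifferential_tmul (x y z : A) :
    barDifferential K A ((x ⊗ₜ y) ⊗ₜ z) = (x * y) ⊗ₜ z - x ⊗ₜ (y * z) := rfl

theorem barDifferential_left (a : A) (m : (A ⊗[K] A) ⊗[K] A) :
    barDifferential K A (((a ⊗ₜ 1) ⊗ₜ 1) * m) = (a ⊗ₜ 1) * barDifferential K A m := by
  refine LinearMap.congr_fun (f := barDifferential K A ∘ₗ LinearMap.mulLeft K _)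
    (g := LinearMap.mulLeft K _ ∘ₗ barDifferential K A) (TensorProduct.ext_threefold ?_) m
  intro x y z
  simp [mul_sub, mul_assoc]

theorem barDifferential_right (a : A) (m : (A ⊗[K] A) ⊗[K] A) :
    barDifferential K A (m * ((1 ⊗ₜ 1) ⊗ₜ a)) = barDifferential K A m * (1 ⊗ₜ a) := by
  refine LinearMap.congr_fun (f := barDifferential K A ∘ₗ LinearMap.mulRight K _)
    (g := LinearMap.mulRight K _ ∘ₗ barDifferential K A) (TensorProduct.ext_threefold ?_) m
  intro x y z
  simp [sub_mul, mul_assoc]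

theorem mul'_barDifferential (m : (A ⊗[K] A) ⊗[K] A) :
    LinearMap.mul' K A (barDifferential K A m) = 0 := by
  refine LinearMap.congr_fun (f := LinearMap.mul' K A ∘ₗ barDifferential K A) (g := 0)
    (TensorProduct.ext_threefold ?_) m
  intro x y z
  simp [mul_assoc]

/-- This is the contracting homotopy of the bar complex; on the kernel of multiplication it makes `z
↦ 1 ⊗ z` a linear splitting. -/
theorem barDifferential_one_tmul (z : A ⊗[K] A) :
    barDifferential K A ((TensorProduct.assoc K A A A).symm (1 ⊗ₜ z)) =
      z - 1 ⊗ₜ LinearMap.mul' K A z := by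
  induction z with
  | zero => simp
  | add p q hp hq => simp only [tmul_add, map_add, hp, hq]; abel
  | tmul x y => simp

variable (K A) in
/-- The bimodule `A ⊗ A ⊗ A`, with the actions of `A` on the outer factors. -/
def OuterBimodule : Type v := (A ⊗[K] A) ⊗[K] A

namespace OuterBimodule

instance : AddCommGroup (OuterBimodule K A) := inferInstanceAs (AddCommGroup ((A ⊗[K] A) ⊗[K] A))

instance : Module K (OuterBimodule K A) := inferInstanceAs (Module K ((A ⊗[K] A) ⊗[K] A))

instance : Module A (OuterBimodule K A) :=
  Module.compHom ((A ⊗[K] A) ⊗[K] A)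
    ((Algebra.TensorProduct.includeLeft (R := K) (S := K) (A := A ⊗[K] A) (B := A)).comp
      (Algebra.TensorProduct.includeLeft (R := K) (S := K) (A := A) (B := A))).toRingHom

instance : Module Aᵐᵒᵖ (OuterBimodule K A) :=
  Module.compHom ((A ⊗[K] A) ⊗[K] A)
    (Algebra.TensorProduct.includeRight (R := K) (A := A ⊗[K] A) (B := A)).op.toRingHom

instance : IsScalarTower K A (OuterBimodule K A) where
  smul_assoc k a m := by
    have h (z : (A ⊗[K] A) ⊗[K] A) :
        (((k • a) ⊗ₜ 1) ⊗ₜ 1) * z = k • (((a ⊗ₜ 1) ⊗ₜ 1) * z) := by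
      rw [← TensorProduct.smul_tmul', ← TensorProduct.smul_tmul', smul_mul_assoc]
    exact h m

instance : IsScalarTower K Aᵐᵒᵖ (OuterBimodule K A) where
  smul_assoc k a m := by
    have h (z : (A ⊗[K] A) ⊗[K] A) : z * (1 ⊗ₜ (k • a.unop)) = k • (z * (1 ⊗ₜ a.unop)) := by
      rw [TensorProduct.tmul_smul, mul_smul_comm]
    exact h m

instance : SMulCommClass A Aᵐᵒᵖ (OuterBimodule K A) where
  smul_comm a b m := by
    have h (z : (A ⊗[K] A) ⊗[K] A) :
        ((a ⊗ₜ 1) ⊗ₜ 1) * (z * (1 ⊗ₜ b.unop)) = ((a ⊗ₜ 1) ⊗ₜ 1) * z * (1 ⊗ₜ b.unop) :=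
      (mul_assoc _ _ _).symm
    exact h m

end OuterBimodule

/-- For a formally smooth algebra, the universal derivation `a ↦ a ⊗ 1 - 1 ⊗ a` lifts along the bar
differential to a derivation. -/
theorem IsFormallySmoothAlgebra.exists_derivation (hA : IsFormallySmoothAlgebra K A) :
    ∃ D : A →ₗ[K] (A ⊗[K] A) ⊗[K] A,
      (∀ x y, D (x * y) = ((x ⊗ₜ 1) ⊗ₜ 1) * D y + D x * ((1 ⊗ₜ 1) ⊗ₜ y)) ∧
      ∀ x, barDifferential K A (D x) = x ⊗ₜ 1 - 1 ⊗ₜ x := by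
  let g : OuterBimodule K A →ₗ[K] OmegaOne K A :=
    (barDifferential K A).codRestrict _ mul'_barDifferential
  let t : OmegaOne K A →ₗ[K] OuterBimodule K A :=
    (TensorProduct.assoc K A A A).symm.toLinearMap ∘ₗ TensorProduct.mk K A (A ⊗[K] A) 1 ∘ₗ
      (LinearMap.ker (LinearMap.mul' K A)).subtype
  -- Lifting the identity of `Ω¹A` gives a bimodule section `i` of the bar differential; `D` is `i`
  -- after the universal derivation.
  obtain ⟨i, hi, hgi⟩ := hA (OuterBimodule K A) (OmegaOne K A) g
    ⟨fun a x => Subtype.ext (barDifferential_left a x),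
      fun a x => Subtype.ext (barDifferential_right a x)⟩
    ⟨t, by
      ext z
      refine (barDifferential_one_tmul (z : A ⊗[K] A)).trans ?_
      rw [LinearMap.mem_ker.1 z.2, tmul_zero, sub_zero]
      rfl⟩
    LinearMap.id ⟨fun _ _ => rfl, fun _ _ => rfl⟩
  let d : A →ₗ[K] OmegaOne K A :=
    ((TensorProduct.mk K A A).flip 1 - TensorProduct.mk K A A 1).codRestrict _ (by
      intro x; simp)
  have hd (x : A) : (d x : A ⊗[K] A) = x ⊗ₜ 1 - 1 ⊗ₜ x := rfl
  let D : A →ₗ[K] (A ⊗[K] A) ⊗[K] A := i ∘ₗ d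
  refine ⟨D, fun x y => ?_, fun x => ?_⟩
  · have : d (x * y) = x • d y + MulOpposite.op y • d x := by
      apply Subtype.ext
      rw [Submodule.coe_add, OmegaOne.coe_smul, OmegaOne.coe_op_smul, hd, hd, hd]
      simp [mul_sub, sub_mul]
    have h : i (d (x * y)) = x • i (d y) + MulOpposite.op y • i (d x) := by
      rw [this, map_add, hi.map_left, hi.map_right]
    exact h
  · exact congrArg Subtype.val (LinearMap.congr_fun hgi (d x))

end BarComplex

/-! ### Making the derivation colinear. -/

namespace RightComodule

open TensorProduct Coalgebra

variable {K : Type u} {H : Type v} [Field K] [Ring H]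

theorem isRightColinear_mul' [Bialgebra K H] : IsRightColinear
    ((regular K H).tensor (regular K H)) (regular K H) (LinearMap.mul' K H) := by
  apply TensorProduct.ext'
  intro x y
  simp only [LinearMap.comp_apply, tensor_coact_tmul, rTensor_mul'_collectCoeff]
  exact Bialgebra.comul_mul x y

theorem twist_id_tmul [Bialgebra K H] (M : RightComodule K H (H ⊗[K] H)) (x : H ⊗[K] H) (h : H) :
    M.twist LinearMap.id (x ⊗ₜ h) = M.coact x * (1 ⊗ₜ h) := by
  rw [twist_tmul]
  induction M.coact x with
  | zero => simp
  | add p q hp hq => simp only [map_add, add_mul, hp, hq]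
  | tmul y a => simp

/-- Multiplicativity of `Δ` turns left multiplication by `x` into left multiplication by `(x₁ ⊗ 1) ⊗
x₂`. -/
theorem twist_id_left [Bialgebra K H] (x : H) (w : (H ⊗[K] H) ⊗[K] H) :
    ((regular K H).tensor (regular K H)).twist LinearMap.id (((x ⊗ₜ 1) ⊗ₜ 1) * w) =
      ((TensorProduct.mk K H H).flip 1).rTensor H (comul x) *
        ((regular K H).tensor (regular K H)).twist LinearMap.id w := by
  have key (p q r : H ⊗[K] H) : collectCoeff K H H H ((p * q) ⊗ₜ r) =
      ((TensorProduct.mk K H H).flip 1).rTensor H p * collectCoeff K H H H (q ⊗ₜ r) := by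
    induction p with
    | zero => simp
    | add p p' hp hp' => simp only [add_mul, add_tmul, map_add, hp, hp']
    | tmul x a =>
      refine TensorProduct.apply_tmul_eq_of_tmul_tmul
        (f := collectCoeff K H H H ∘ₗ (LinearMap.mulLeft K (x ⊗ₜ a)).rTensor (H ⊗[K] H))
        (g := LinearMap.mulLeft K (((TensorProduct.mk K H H).flip 1).rTensor H (x ⊗ₜ a)) ∘ₗ
          collectCoeff K H H H) ?_ q r
      intro y b z c
      simp [mul_assoc]
  refine LinearMap.congr_fun
    (f := ((regular K H).tensor (regular K H)).twist LinearMap.id ∘ₗ LinearMap.mulLeft K _)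
    (g := LinearMap.mulLeft K _ ∘ₗ ((regular K H).tensor (regular K H)).twist LinearMap.id)
    (TensorProduct.ext_threefold ?_) w
  intro a b c
  simp only [LinearMap.comp_apply, LinearMap.mulLeft_apply, Algebra.TensorProduct.tmul_mul_tmul,
    one_mul, twist_id_tmul, tensor_coact_tmul]
  have h : (regular K H).coact (x * a) = comul x * (regular K H).coact a :=
    Bialgebra.comul_mul x a
  rw [← mul_assoc, ← key, h]

theorem twist_antipode_left [HopfAlgebra K H] (x : H) (z : (H ⊗[K] H) ⊗[K] H) :
    ((regular K H).tensor (regular K H)).twist (HopfAlgebra.antipode K)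
        (((TensorProduct.mk K H H).flip 1).rTensor H (comul x) * z) = ((x ⊗ₜ 1) ⊗ₜ 1) *
      ((regular K H).tensor (regular K H)).twist (HopfAlgebra.antipode K) z := by
  rw [← twist_antipode_twist_id ((regular K H).tensor (regular K H)) (((x ⊗ₜ 1) ⊗ₜ 1) * _),
    twist_id_left, twist_id_twist_antipode]

theorem twist_right [Bialgebra K H] (M : RightComodule K H (H ⊗[K] H)) (φ : H →ₗ[K] H) (y : H)
    (z : (H ⊗[K] H) ⊗[K] H) : M.twist φ (z * (1 ⊗ₜ y)) = M.twist φ z * (1 ⊗ₜ y) := by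
  induction z with
  | zero => simp
  | add p q hp hq => simp only [map_add, add_mul, hp, hq]
  | tmul x h =>
    rw [Algebra.TensorProduct.tmul_mul_tmul, mul_one, twist_tmul, twist_tmul]
    induction M.coact x with
    | zero => simp
    | add p q hp hq => simp only [map_add, add_mul, hp, hq]
    | tmul y a => simp [mul_assoc]

variable (K H) in
/-- The map `x ⊗ y ↦ x * y - ε y • x`. -/
def augmentedMul [Bialgebra K H] : H ⊗[K] H →ₗ[K] H :=
  LinearMap.mul' K H - (TensorProduct.rid K H).toLinearMap ∘ₗ counit.lTensor H

/-- After conjugation by the twists the differential acts only on the first two factors. Indeed `x₁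
* y₁ ⊗ x₂ * y₂ * z` and `x₁ ε(y₁) ⊗ x₂ * y₂ * z` are the twists by the identity of `x * y ⊗ z` and
`x ⊗ y * z`. -/
theorem barDifferential_eq_twist [HopfAlgebra K H] (w : (H ⊗[K] H) ⊗[K] H) :
    barDifferential K H w = (regular K H).twist (HopfAlgebra.antipode K)
      ((augmentedMul K H).rTensor H
        (((regular K H).tensor (regular K H)).twist LinearMap.id w)) := by
  rw [augmentedMul, LinearMap.rTensor_sub, LinearMap.sub_apply,
    ← twist_map isRightColinear_mul', map_sub, twist_antipode_twist_id, barDifferential,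
    LinearMap.sub_apply]
  congr 1
  have key (p q : H ⊗[K] H) :
      ((TensorProduct.rid K H).toLinearMap ∘ₗ counit.lTensor H).rTensor H
        (collectCoeff K H H H (p ⊗ₜ q)) =
      p * (1 ⊗ₜ TensorProduct.lid K H ((counit (R := K)).rTensor H q)) := by
    refine TensorProduct.apply_tmul_eq_of_tmul_tmul
      (f := ((TensorProduct.rid K H).toLinearMap ∘ₗ counit.lTensor H).rTensor H ∘ₗ
        collectCoeff K H H H)
      (g := LinearMap.mul' K _ ∘ₗ (TensorProduct.mk K H H 1 ∘ₗ
        (TensorProduct.lid K H).toLinearMap ∘ₗ (counit (R := K)).rTensor H).lTensor _) ?_ p q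
    intro x a y b
    simp [smul_tmul']
  have key' (m : (H ⊗[K] H) ⊗[K] H) (h : H) :
      ((TensorProduct.rid K H).toLinearMap ∘ₗ counit.lTensor H).rTensor H (m * (1 ⊗ₜ h)) =
      ((TensorProduct.rid K H).toLinearMap ∘ₗ counit.lTensor H).rTensor H m * (1 ⊗ₜ h) := by
    induction m with
    | zero => simp
    | add p q hp hq => simp only [map_add, add_mul, hp, hq]
    | tmul x a => simp
  refine LinearMap.congr_fun
    (f := (LinearMap.mul' K H).lTensor H ∘ₗ (TensorProduct.assoc K H H H).toLinearMap)
    (g := (regular K H).twist (HopfAlgebra.antipode K) ∘ₗ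
      ((TensorProduct.rid K H).toLinearMap ∘ₗ counit.lTensor H).rTensor H ∘ₗ
      ((regular K H).tensor (regular K H)).twist LinearMap.id)
    (TensorProduct.ext_threefold ?_) w
  intro x y z
  simp only [LinearMap.comp_apply, twist_id_tmul, tensor_coact_tmul]
  rw [key', key]
  have hy : TensorProduct.lid K H ((counit (R := K)).rTensor H ((regular K H).coact y)) = y := by
    simp [regular]
  have hx : (regular K H).coact x * (1 ⊗ₜ y) * (1 ⊗ₜ z) =
      (regular K H).twist LinearMap.id (x ⊗ₜ (y * z)) := by
    rw [twist_tmul]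
    induction (regular K H).coact x with
    | zero => simp
    | add p q hp hq => simp only [map_add, add_mul, hp, hq]
    | tmul x' a => simp [mul_assoc]
  rw [hy, hx, twist_antipode_twist_id]
  simp

/-- The derivation of `exists_derivation` can be taken right colinear over a Hopf algebra. -/
theorem _root_.IsFormallySmoothAlgebra.exists_colinear_derivation [HopfAlgebra K H]
    (hH : IsFormallySmoothAlgebra K H) :
    ∃ D : H →ₗ[K] (H ⊗[K] H) ⊗[K] H,
      (∀ x y, D (x * y) = ((x ⊗ₜ 1) ⊗ₜ 1) * D y + D x * (1 ⊗ₜ y)) ∧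
      (∀ x, barDifferential K H (D x) = x ⊗ₜ 1 - 1 ⊗ₜ x) ∧
      IsRightColinear (regular K H)
        (((regular K H).tensor (regular K H)).tensor (regular K H)) D := by
  obtain ⟨D₀, hD₀, hbD₀⟩ := hH.exists_derivation
  -- Applying `ε` to the last factor leaves a derivation whose right action is through `ε`.
  let D₁ : H →ₗ[K] H ⊗[K] H :=
    (TensorProduct.rid K (H ⊗[K] H)).toLinearMap ∘ₗ counit.lTensor (H ⊗[K] H) ∘ₗ D₀
  have hD₁ (x y : H) : D₁ (x * y) = (x ⊗ₜ 1) * D₁ y + counit (R := K) y • D₁ x := by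
    have h1 (m : (H ⊗[K] H) ⊗[K] H) : TensorProduct.rid K (H ⊗[K] H)
        ((counit (R := K)).lTensor _ (((x ⊗ₜ 1) ⊗ₜ 1) * m)) =
        (x ⊗ₜ 1) * TensorProduct.rid K (H ⊗[K] H) ((counit (R := K)).lTensor _ m) := by
      induction m with
      | zero => simp
      | add p q hp hq => simp only [map_add, mul_add, hp, hq]
      | tmul z a => simp
    have h2 (m : (H ⊗[K] H) ⊗[K] H) : TensorProduct.rid K (H ⊗[K] H)
        ((counit (R := K)).lTensor _ (m * ((1 ⊗ₜ 1) ⊗ₜ y))) =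
        counit (R := K) y • TensorProduct.rid K (H ⊗[K] H) ((counit (R := K)).lTensor _ m) := by
      induction m with
      | zero => simp
      | add p q hp hq => simp only [map_add, add_mul, smul_add, hp, hq]
      | tmul z a =>
        simp [← Algebra.TensorProduct.one_def, smul_smul, mul_comm]
    simp only [D₁, LinearMap.comp_apply, LinearEquiv.coe_coe, hD₀, map_add, h1, h2]
  have hbD₁ (x : H) : augmentedMul K H (D₁ x) = x - algebraMap K H (counit x) := by
    have h1 : augmentedMul K H ∘ₗ (TensorProduct.rid K (H ⊗[K] H)).toLinearMap ∘ₗ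
        counit.lTensor (H ⊗[K] H) =
        (TensorProduct.rid K H).toLinearMap ∘ₗ counit.lTensor H ∘ₗ barDifferential K H := by
      apply TensorProduct.ext_threefold
      intro a b c
      simp [augmentedMul, smul_sub, smul_smul, mul_comm]
    have h2 := LinearMap.congr_fun h1 (D₀ x)
    simp only [LinearMap.comp_apply, hbD₀] at h2
    refine h2.trans ?_
    simp [Algebra.algebraMap_eq_smul_one]
  let T := ((regular K H).tensor (regular K H)).twist (HopfAlgebra.antipode K)
  -- The colinear derivation is `x ↦ T (D₁ x₁ ⊗ x₂)`: both `Δ` and `D₁ ⊗ id` respect the coaction on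
  -- the right factor, and `T` takes it to the diagonal one.
  refine ⟨T ∘ₗ D₁.rTensor H ∘ₗ comul, fun x y => ?_, fun x => ?_, ?_⟩
  · have key (p q : H ⊗[K] H) : D₁.rTensor H (p * q) =
        ((TensorProduct.mk K H H).flip 1).rTensor H p * D₁.rTensor H q +
        D₁.rTensor H p * (1 ⊗ₜ TensorProduct.lid K H ((counit (R := K)).rTensor H q)) := by
      induction p with
      | zero => simp
      | add p p' hp hp' => simp only [add_mul, map_add, hp, hp']; abel
      | tmul x a =>
        induction q with
        | zero => simp
        | add p p' hp hp' => simp only [mul_add, map_add, tmul_add, hp, hp']; abel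
        | tmul y b => simp [hD₁, add_tmul, smul_tmul']
    simp only [LinearMap.comp_apply, T, Bialgebra.comul_mul, key, map_add, twist_antipode_left,
      rTensor_counit_comul, TensorProduct.lid_tmul, one_smul, twist_right]
  · have h1 : augmentedMul K H ∘ₗ D₁ = LinearMap.id - Algebra.linearMap K H ∘ₗ counit :=
      LinearMap.ext hbD₁
    have h2 : (regular K H).twist (HopfAlgebra.antipode K) (1 ⊗ₜ x) = 1 ⊗ₜ x := by
      rw [twist_tmul]
      simp [regular, Algebra.TensorProduct.one_def]
    simp only [LinearMap.comp_apply, T, barDifferential_eq_twist, twist_id_twist_antipode]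
    rw [← LinearMap.rTensor_comp_apply, h1, LinearMap.rTensor_sub, LinearMap.sub_apply,
      LinearMap.rTensor_id, LinearMap.rTensor_comp_apply, rTensor_counit_comul, map_sub]
    congr 1
    · exact (regular K H).twist_antipode_coact x
    · simpa using h2
  · apply LinearMap.ext
    intro x
    simp only [LinearMap.comp_apply, T, tensor_coact_twist_antipode, LinearMap.rTensor_comp]
    congr 1
    have key (p : H ⊗[K] H) : (TensorProduct.assoc K (H ⊗[K] H) H H).symm
        ((comul (R := K)).lTensor _ (D₁.rTensor H p)) = (D₁.rTensor H).rTensor H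
          ((TensorProduct.assoc K H H H).symm ((comul (R := K)).lTensor H p)) := by
      induction p with
      | zero => simp
      | add p q hp hq => simp only [map_add, hp, hq]
      | tmul a b =>
        simp only [LinearMap.rTensor_tmul, LinearMap.lTensor_tmul]
        induction comul (R := K) b with
        | zero => simp
        | add p q hp hq => simp only [map_add, tmul_add, hp, hq]
        | tmul c d => simp
    rw [key, coassoc_symm_apply]
    rfl

end RightComodule

/-! ### Correcting a section modulo the square of an ideal. -/

section Lifting

open TensorProduct Coalgebra RightComodule

variable {K : Type u} {H : Type v} {E : Type w} [Field K] [Ring H] [Ring E] [Algebra K E]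

/-- The subspace `J ⊗ H` of `E ⊗ H`, for an ideal `J` of `E`. -/
def Ideal.tensorRange (K : Type u) (H : Type v) [Field K] [Ring H] [Algebra K H] [Algebra K E]
    (J : Ideal E) : Submodule K (E ⊗[K] H) :=
  LinearMap.range ((J.restrictScalars K).subtype.rTensor H)

namespace Ideal

section

variable [Algebra K H] {J J' : Ideal E}

theorem tmul_mem_tensorRange {x : E} (hx : x ∈ J) (h : H) : x ⊗ₜ h ∈ J.tensorRange K H :=
  ⟨(⟨x, hx⟩ : J.restrictScalars K) ⊗ₜ h, rfl⟩

theorem tensorRange_le {N : Submodule K (E ⊗[K] H)} (h : ∀ x ∈ J, ∀ a, x ⊗ₜ a ∈ N) :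
    J.tensorRange K H ≤ N := by
  rintro _ ⟨z, rfl⟩
  induction z with
  | zero => simp
  | add p q hp hq => rw [map_add]; exact N.add_mem hp hq
  | tmul x a => exact h x x.2 a

theorem mul_mem_tensorRange {x y : E ⊗[K] H} (hx : x ∈ J.tensorRange K H)
    (hy : y ∈ J'.tensorRange K H) : x * y ∈ (J * J').tensorRange K H := by
  have h : J.tensorRange K H ≤
      ((J * J').tensorRange K H).comap (LinearMap.mulRight K y) := by
    refine tensorRange_le fun a ha c => ?_
    have h' : J'.tensorRange K H ≤
        ((J * J').tensorRange K H).comap (LinearMap.mulLeft K (a ⊗ₜ c)) :=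
      tensorRange_le fun b hb d => by
        simpa using tmul_mem_tensorRange (Ideal.mul_mem_mul ha hb) (c * d)
    exact h' hy
  exact h hx

theorem tensorRange_bot : (⊥ : Ideal E).tensorRange K H = ⊥ := by
  refine le_bot_iff.1 (tensorRange_le fun x hx a => ?_)
  rw [Ideal.mem_bot.1 hx, zero_tmul]
  exact zero_mem _

/-- Right exactness of `- ⊗ H`. -/
theorem mem_tensorRange_ker_iff {B : Type*} [Ring B] [Algebra K B] {f : E →ₐ[K] B}
    (hf : Function.Surjective f) (z : E ⊗[K] H) :
    z ∈ (RingHom.ker f).tensorRange K H ↔ f.toLinearMap.rTensor H z = 0 := by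
  have h : Function.Exact ((RingHom.ker f).restrictScalars K).subtype f.toLinearMap := by
    intro x
    simp [RingHom.mem_ker]
  exact (rTensor_exact H h hf z).symm

end

end Ideal

variable [Bialgebra K H]

/-- The coaction of `M` on the algebra `E` is an algebra homomorphism. -/
structure RightComodule.IsComoduleAlgebra (M : RightComodule K H E) : Prop where
  coact_one : M.coact 1 = 1
  coact_mul : ∀ x y, M.coact (x * y) = M.coact x * M.coact y

theorem RightComodule.isComoduleAlgebra_ofCoalgHom {E : Type w} [Ring E] [Bialgebra K E]
    (π : E →ₐc[K] H) : (ofCoalgHom (π : E →ₗc[K] H)).IsComoduleAlgebra := by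
  have h (x : E) : (ofCoalgHom (π : E →ₗc[K] H)).coact x =
      Algebra.TensorProduct.map (AlgHom.id K E) (π : E →ₐ[K] H) (comul x) := rfl
  exact ⟨by rw [h, Bialgebra.comul_one, map_one],
    fun x y => by rw [h, Bialgebra.comul_mul, map_mul]; rfl⟩

theorem IsRightColinear.apply {V W : Type*} [AddCommGroup V] [Module K V] [AddCommGroup W]
    [Module K W] {M : RightComodule K H V} {N : RightComodule K H W} {f : V →ₗ[K] W}
    (hf : IsRightColinear M N f) (x : V) : N.coact (f x) = f.rTensor H (M.coact x) :=
  LinearMap.congr_fun hf x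

theorem IsRightColinear.comp {V W U : Type*} [AddCommGroup V] [Module K V] [AddCommGroup W]
    [Module K W] [AddCommGroup U] [Module K U] {M : RightComodule K H V}
    {N : RightComodule K H W} {L : RightComodule K H U} {g : W →ₗ[K] U} {f : V →ₗ[K] W}
    (hg : IsRightColinear N L g) (hf : IsRightColinear M N f) : IsRightColinear M L (g ∘ₗ f) := by
  apply LinearMap.ext
  intro x
  simp only [LinearMap.comp_apply, hg.apply, hf.apply, LinearMap.rTensor_comp]

theorem IsRightColinear.sub {V W : Type*} [AddCommGroup V] [Module K V] [AddCommGroup W]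
    [Module K W] {M : RightComodule K H V} {N : RightComodule K H W} {f g : V →ₗ[K] W}
    (hf : IsRightColinear M N f) (hg : IsRightColinear M N g) : IsRightColinear M N (f - g) := by
  apply LinearMap.ext
  intro x
  simp only [LinearMap.comp_apply, LinearMap.sub_apply, map_sub, hg.apply, hf.apply,
    LinearMap.rTensor_sub]

theorem RightComodule.IsComoduleAlgebra.isRightColinear_mul' {V W : Type*} [AddCommGroup V]
    [Module K V] [AddCommGroup W] [Module K W] {M : RightComodule K H E}
    (hM : M.IsComoduleAlgebra) {L : RightComodule K H V} {N : RightComodule K H W}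
    {f : V →ₗ[K] E} {g : W →ₗ[K] E} (hf : IsRightColinear L M f) (hg : IsRightColinear N M g) :
    IsRightColinear (L.tensor N) M (LinearMap.mul' K E ∘ₗ TensorProduct.map f g) := by
  apply TensorProduct.ext'
  intro x y
  simp only [LinearMap.comp_apply, TensorProduct.map_tmul, LinearMap.mul'_apply, hM.coact_mul,
    hf.apply, hg.apply, tensor_coact_tmul, LinearMap.rTensor_comp, rTensor_map_collectCoeff,
    rTensor_mul'_collectCoeff]

theorem coact_mul_mem_tensorRange {M : RightComodule K H E} (hM : M.IsComoduleAlgebra)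
    {J : Ideal E} (hJ : ∀ x ∈ J, M.coact x ∈ J.tensorRange K H) :
    ∀ x ∈ J * J, M.coact x ∈ (J * J).tensorRange K H := by
  intro x hx
  induction hx using Submodule.mul_induction_on' with
  | mem_mul_mem a ha b hb =>
    rw [hM.coact_mul]
    exact Ideal.mul_mem_tensorRange (hJ a ha) (hJ b hb)
  | add a _ b _ ha hb => rw [map_add]; exact add_mem ha hb

/-- A linear map from `H` that is right colinear modulo `J` can be changed, within `J`, to one that
is right colinear modulo `J * J`. -/
theorem exists_colinear_mod_mul_self {H : Type v} [Ring H] [HopfAlgebra K H]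
    {M : RightComodule K H E} (hM : M.IsComoduleAlgebra) {J : Ideal E} [J.IsTwoSided]
    (hJ : ∀ x ∈ J, M.coact x ∈ J.tensorRange K H) {σ : H →ₗ[K] E} (hσ1 : σ 1 = 1)
    (hσ : ∀ h, M.coact (σ h) - σ.rTensor H (comul h) ∈ J.tensorRange K H) :
    ∃ τ : H →ₗ[K] E, τ 1 = 1 ∧ (∀ h, σ h - τ h ∈ J) ∧
      ∀ h, M.coact (τ h) - τ.rTensor H (comul h) ∈ (J * J).tensorRange K H := by
  let T := M.twist (HopfAlgebra.antipode K)
  let Λ : E ⊗[K] H →ₗ[K] E := LinearMap.mul' K E ∘ₗ σ.lTensor E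
  let δ : H →ₗ[K] E ⊗[K] H := M.coact ∘ₗ σ - σ.rTensor H ∘ₗ comul
  let τ : H →ₗ[K] E := Λ ∘ₗ T ∘ₗ σ.rTensor H ∘ₗ comul
  have hδ (h : H) : δ h ∈ J.tensorRange K H := hσ h
  have hT : J.tensorRange K H ≤ (J.tensorRange K H).comap T := by
    refine Ideal.tensorRange_le fun x hx h => ?_
    have h1 : J.tensorRange K H ≤ (J.tensorRange K H).comap
        ((LinearMap.mulRight K h ∘ₗ HopfAlgebra.antipode K).lTensor E) :=
      Ideal.tensorRange_le fun x hx a => Ideal.tmul_mem_tensorRange hx _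
    rw [Submodule.mem_comap, twist_tmul]
    exact h1 (hJ x hx)
  have hΛ : J.tensorRange K H ≤ (J.restrictScalars K).comap Λ :=
    Ideal.tensorRange_le fun x hx h => J.mul_mem_right (σ h) hx
  have hz (h : H) : T (σ.rTensor H (comul h)) = σ h ⊗ₜ 1 - T (δ h) := by
    have : σ.rTensor H (comul h) = M.coact (σ h) - δ h := by simp [δ]
    rw [this, map_sub]
    congr 1
    exact M.twist_antipode_coact (σ h)
  -- The change is governed by the colinearity defect `δ`; `σ 1 = 1` gives `Λ (σ h ⊗ 1) = σ h`.
  have hτ (h : H) : τ h = σ h - Λ (T (δ h)) := by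
    change Λ (T (σ.rTensor H (comul h))) = _
    rw [hz, map_sub]
    simp [Λ, hσ1]
  -- `F` is the failure of `Λ` to be colinear for the diagonal coaction. As `F (x ⊗ h)` is the
  -- coaction of `x` times `δ h`, it gains a second factor from `J` on `J ⊗ H`.
  let F : E ⊗[K] H →ₗ[K] E ⊗[K] H :=
    M.coact ∘ₗ Λ - Λ.rTensor H ∘ₗ (M.tensor (regular K H)).coact
  have hF (x : E) (h : H) : F (x ⊗ₜ h) = M.coact x * δ h := by
    have h1 : Λ = LinearMap.mul' K E ∘ₗ TensorProduct.map LinearMap.id σ := rfl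
    simp only [F, LinearMap.sub_apply, LinearMap.comp_apply, tensor_coact_tmul, h1,
      LinearMap.rTensor_comp, rTensor_map_collectCoeff, rTensor_mul'_collectCoeff, map_tmul,
      LinearMap.mul'_apply, hM.coact_mul, δ, mul_sub, LinearMap.id_apply, LinearMap.rTensor_id]
    rfl
  have hδ1 : δ 1 = 0 := by
    simp [δ, hσ1, hM.coact_one, Algebra.TensorProduct.one_def]
  have hFJ : J.tensorRange K H ≤ ((J * J).tensorRange K H).comap F := by
    refine Ideal.tensorRange_le fun x hx h => ?_
    rw [Submodule.mem_comap, hF]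
    exact Ideal.mul_mem_tensorRange (hJ x hx) (hδ h)
  refine ⟨τ, by simp [hτ, hσ1, hδ1], fun h => ?_, fun h => ?_⟩
  · rw [hτ, sub_sub_cancel]
    exact hΛ (hT (hδ h))
  -- All maps composing `τ` other than `Λ` respect the coactions, so the defect of `τ` comes from
  -- `F` alone.
  · have h1 : M.coact (τ h) - τ.rTensor H (comul h) = F (T (σ.rTensor H (comul h))) := by
      simp only [F, LinearMap.sub_apply, LinearMap.comp_apply, T, tensor_coact_twist_antipode]
      congr 1
      have key (p : H ⊗[K] H) : (TensorProduct.assoc K E H H).symm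
          ((comul (R := K)).lTensor _ (σ.rTensor H p)) = (σ.rTensor H).rTensor H
            ((TensorProduct.assoc K H H H).symm ((comul (R := K)).lTensor H p)) := by
        induction p with
        | zero => simp
        | add p q hp hq => simp only [map_add, hp, hq]
        | tmul a b =>
          simp only [LinearMap.rTensor_tmul, LinearMap.lTensor_tmul]
          induction comul (R := K) b with
          | zero => simp
          | add p q hp hq => simp only [map_add, tmul_add, hp, hq]
          | tmul c d => simp
      rw [key, coassoc_symm_apply]
      simp only [τ, LinearMap.rTensor_comp, LinearMap.comp_apply]
      rfl
    rw [h1, hz, map_sub, hF, hδ1, mul_zero, zero_sub]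
    exact neg_mem (hFJ (hT (hδ h)))

/-- A right colinear map from `H` that is multiplicative modulo `J` can be changed, within `J`, to
one that is multiplicative modulo `J * J`. -/
theorem exists_multiplicative_mod_mul_self {M : RightComodule K H E} (hM : M.IsComoduleAlgebra)
    {J : Ideal E} [J.IsTwoSided] {D : H →ₗ[K] (H ⊗[K] H) ⊗[K] H}
    (hD : ∀ x y, D (x * y) = ((x ⊗ₜ 1) ⊗ₜ 1) * D y + D x * (1 ⊗ₜ y))
    (hbD : ∀ x, barDifferential K H (D x) = x ⊗ₜ 1 - 1 ⊗ₜ x)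
    (hDcol : IsRightColinear (regular K H)
      (((regular K H).tensor (regular K H)).tensor (regular K H)) D)
    {s : H →ₗ[K] E} (hs1 : s 1 = 1) (hscol : IsRightColinear (regular K H) M s)
    (hs : ∀ x y, s (x * y) - s x * s y ∈ J) :
    ∃ r : H →ₗ[K] E, r 1 = 1 ∧ IsRightColinear (regular K H) M r ∧ (∀ h, s h - r h ∈ J) ∧
      ∀ x y, r (x * y) - r x * r y ∈ J * J := by
  let ω : H ⊗[K] H →ₗ[K] E := s ∘ₗ LinearMap.mul' K H - LinearMap.mul' K E ∘ₗ TensorProduct.map s s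
  have hω (x y : H) : ω (x ⊗ₜ y) = s (x * y) - s x * s y := rfl
  have hωJ (x y : H) : ω (x ⊗ₜ y) ∈ J := hs x y
  let Ω : (H ⊗[K] H) ⊗[K] H →ₗ[K] E := LinearMap.mul' K E ∘ₗ TensorProduct.map ω s
  have hΩ (x y z : H) : Ω ((x ⊗ₜ y) ⊗ₜ z) = (s (x * y) - s x * s y) * s z := rfl
  have hΩJ (m : (H ⊗[K] H) ⊗[K] H) : Ω m ∈ J := by
    induction m with
    | zero => simp
    | add p q hp hq => rw [map_add]; exact add_mem hp hq
    | tmul p z =>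
      induction p with
      | zero => simp
      | add p q hp hq => rw [add_tmul, map_add]; exact add_mem hp hq
      | tmul x y => exact J.mul_mem_right _ (hωJ x y)
  let G (x : H) : H ⊗[K] H →ₗ[K] E :=
    LinearMap.mul' K E ∘ₗ TensorProduct.map (ω ∘ₗ TensorProduct.mk K H H x) s
  have hG (x y z : H) : G x (y ⊗ₜ z) = (s (x * y) - s x * s y) * s z := rfl
  -- The cocycle property of `ω`: on `(u ⊗ v) ⊗ z` the difference is exactly `ω (x ⊗ u) * ω (v ⊗
  -- z)`.
  have hleft (x : H) (m : (H ⊗[K] H) ⊗[K] H) :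
      Ω (((x ⊗ₜ 1) ⊗ₜ 1) * m) - s x * Ω m - G x (barDifferential K H m) ∈ J * J := by
    induction m with
    | zero => simp
    | add p q hp hq =>
      simp only [mul_add, map_add]
      convert add_mem hp hq using 1
      abel
    | tmul p z =>
      induction p with
      | zero => simp
      | add p q hp hq =>
        simp only [mul_add, map_add, add_tmul]
        convert add_mem hp hq using 1
        abel
      | tmul u v =>
        convert Ideal.mul_mem_mul (hωJ x u) (hωJ v z) using 1
        simp only [Algebra.TensorProduct.tmul_mul_tmul, barDifferential_tmul, map_sub, hΩ, hG, hω,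
          one_mul, mul_assoc]
        noncomm_ring
  have hright (y : H) (m : (H ⊗[K] H) ⊗[K] H) : Ω (m * (1 ⊗ₜ y)) - Ω m * s y ∈ J * J := by
    induction m with
    | zero => simp
    | add p q hp hq =>
      simp only [add_mul, map_add]
      convert add_mem hp hq using 1
      abel
    | tmul p z =>
      induction p with
      | zero => simp
      | add p q hp hq =>
        simp only [add_mul, map_add, add_tmul]
        convert add_mem hp hq using 1
        abel
      | tmul u v =>
        convert Ideal.mul_mem_mul (hωJ u v) (hωJ z y) using 1
        simp only [Algebra.TensorProduct.tmul_mul_tmul, hΩ, hω, mul_one]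
        noncomm_ring
  have hD1 : D 1 = 0 := by
    simpa [← Algebra.TensorProduct.one_def] using hD 1 1
  have hωcol : IsRightColinear ((regular K H).tensor (regular K H)) M ω :=
    (hscol.comp RightComodule.isRightColinear_mul').sub
      (hM.isRightColinear_mul' hscol hscol)
  -- Modulo `J * J`, `Ω (D (x * y))` is `s x * Ω (D y) + Ω (D x) * s y + ω (x ⊗ y)`. The last term
  -- is `G x (y ⊗ 1 - 1 ⊗ y)`, since `ω (x ⊗ 1) = 0`; it cancels the curvature of `s`.
  refine ⟨s - Ω ∘ₗ D, by simp [hs1, hD1],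
    hscol.sub ((hM.isRightColinear_mul' hωcol hscol).comp hDcol),
    fun h => by simpa using hΩJ (D h), fun x y => ?_⟩
  have h1 := hleft x (D y)
  have h2 := hright y (D x)
  rw [hbD, map_sub, hG, hG, mul_one, hs1, mul_one, mul_one, sub_self, zero_mul, sub_zero] at h1
  convert neg_mem (add_mem (add_mem h1 h2) (Ideal.mul_mem_mul (hΩJ (D x)) (hΩJ (D y)))) using 1
  simp only [LinearMap.sub_apply, LinearMap.comp_apply, hD, map_add]
  noncomm_ring

end Lifting

/-! ### The two iterations. -/

open RightComodule Coalgebra in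
/-- A surjective bialgebra homomorphism `π : E → H` with nilpotent kernel onto a formally smooth
Hopf algebra has a section that is a right `H`-colinear algebra homomorphism. -/
theorem mainTheorem3 (K : Type u) (H : Type v) (E : Type w) [Field K]
    [Ring H] [HopfAlgebra K H] [Ring E] [Bialgebra K E]
    (π : E →ₐc[K] H) (hπ : Function.Surjective π)
    (hnil : ∃ n : ℕ, RingHom.ker π ^ n = ⊥)
    (hsmooth : IsFormallySmoothAlgebra K H) :
    ∃ s : H →ₐ[K] E, (∀ h : H, π (s h) = h) ∧
      IsRightColinear (RightComodule.regular K H)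
        (RightComodule.ofCoalgHom (π : E →ₗc[K] H)) s.toLinearMap := by
  obtain ⟨n, hn⟩ := hnil
  obtain ⟨D, hD, hbD, hDcol⟩ := hsmooth.exists_colinear_derivation
  set M := RightComodule.ofCoalgHom (π : E →ₗc[K] H)
  have hM : M.IsComoduleAlgebra := isComoduleAlgebra_ofCoalgHom π
  set I : Ideal E := RingHom.ker π
  have : I.IsTwoSided := inferInstanceAs (RingHom.ker (π : E →ₐ[K] H)).IsTwoSided
  have hker (z : E ⊗[K] H) :
      z ∈ I.tensorRange K H ↔ (π : E →ₐ[K] H).toLinearMap.rTensor H z = 0 :=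
    Ideal.mem_tensorRange_ker_iff (f := (π : E →ₐ[K] H)) hπ z
  have hcoact (x : E) : (π : E →ₐ[K] H).toLinearMap.rTensor H (M.coact x) = comul (π x) := by
    refine (LinearMap.congr_fun (LinearMap.rTensor_comp_lTensor _ _ _) (comul x)).trans ?_
    exact CoalgHomClass.map_comp_comul_apply π x
  have hpow (k : ℕ) : I ^ 2 ^ (k + 1) = I ^ 2 ^ k * I ^ 2 ^ k := by
    rw [pow_succ 2 k, mul_two, Submodule.pow_add _ (by positivity)]
  have hpowI (k : ℕ) : I ^ 2 ^ k ≤ I := Ideal.pow_le_self (by positivity)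
  have hbot : I ^ 2 ^ n = ⊥ :=
    le_bot_iff.1 (hn ▸ Ideal.pow_le_pow_right Nat.lt_two_pow_self.le)
  have hJ (k : ℕ) : ∀ x ∈ I ^ 2 ^ k, M.coact x ∈ (I ^ 2 ^ k).tensorRange K H := by
    induction k with
    | zero =>
      intro x hx
      rw [pow_zero, Submodule.pow_one] at hx ⊢
      rw [hker, hcoact, (RingHom.mem_ker).1 hx, map_zero]
    | succ k ih =>
      rw [hpow]
      exact coact_mul_mem_tensorRange hM ih
  have hlin (k : ℕ) : ∃ σ : H →ₗ[K] E, σ 1 = 1 ∧ (∀ h, π (σ h) = h) ∧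
      ∀ h, M.coact (σ h) - σ.rTensor H (comul h) ∈ (I ^ 2 ^ k).tensorRange K H := by
    induction k with
    | zero =>
      obtain ⟨σ₀, hσ₀⟩ := (π : E →ₐ[K] H).toLinearMap.exists_rightInverse_of_surjective
        (LinearMap.range_eq_top.2 hπ)
      have hσ₀' (h : H) : π (σ₀ h) = h := LinearMap.congr_fun hσ₀ h
      -- The added term normalizes the value at `1`, and stays in the kernel because `π (σ₀ 1) = 1`.
      let σ : H →ₗ[K] E := σ₀ + (counit (R := K)).smulRight (1 - σ₀ 1)
      have hσ (h : H) : π (σ h) = h := by simp [σ, hσ₀']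
      refine ⟨σ, by simp [σ], hσ, fun h => ?_⟩
      have h1 : (π : E →ₐ[K] H).toLinearMap ∘ₗ σ = LinearMap.id := LinearMap.ext hσ
      rw [pow_zero, Submodule.pow_one, hker, map_sub, hcoact, hσ, ← LinearMap.rTensor_comp_apply, h1,
        LinearMap.rTensor_id, LinearMap.id_apply, sub_self]
    | succ k ih =>
      obtain ⟨σ, hσ1, hπσ, hσ⟩ := ih
      obtain ⟨τ, hτ1, hστ, hτ⟩ := exists_colinear_mod_mul_self hM (hJ k) hσ1 hσ
      refine ⟨τ, hτ1, fun h => ?_, by rwa [hpow]⟩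
      have := (RingHom.mem_ker).1 (hpowI k (hστ h))
      rw [map_sub, hπσ, sub_eq_zero] at this
      exact this.symm
  have hmul (k : ℕ) : ∃ s : H →ₗ[K] E, s 1 = 1 ∧ (∀ h, π (s h) = h) ∧
      IsRightColinear (regular K H) M s ∧ ∀ x y, s (x * y) - s x * s y ∈ I ^ 2 ^ k := by
    induction k with
    | zero =>
      -- At stage `n` the colinearity error lies in `I ^ 2 ^ n = ⊥`, so the second iteration starts
      -- from an exactly colinear section.
      obtain ⟨σ, hσ1, hπσ, hσ⟩ := hlin n
      refine ⟨σ, hσ1, hπσ, LinearMap.ext fun h => ?_, fun x y => ?_⟩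
      · have := hσ h
        rw [hbot, Ideal.tensorRange_bot, Submodule.mem_bot, sub_eq_zero] at this
        exact this
      · rw [pow_zero, Submodule.pow_one]
        refine (RingHom.mem_ker).2 ?_
        rw [map_sub, hπσ, map_mul, hπσ, hπσ, sub_self]
    | succ k ih =>
      obtain ⟨s, hs1, hπs, hscol, hs⟩ := ih
      obtain ⟨r, hr1, hrcol, hsr, hr⟩ :=
        exists_multiplicative_mod_mul_self hM hD hbD hDcol hs1 hscol hs
      refine ⟨r, hr1, fun h => ?_, hrcol, by rwa [hpow]⟩
      have := (RingHom.mem_ker).1 (hpowI k (hsr h))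
      rw [map_sub, hπs, sub_eq_zero] at this
      exact this.symm
  obtain ⟨s, hs1, hπs, hscol, hs⟩ := hmul n
  refine ⟨AlgHom.ofLinearMap s hs1 fun x y => ?_, hπs, hscol⟩
  have := hs x y
  rwa [hbot, Ideal.mem_bot, sub_eq_zero] at this
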